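/- Let $k$ be a field, let $n \ge 2$, and let $Q_1,\dots,Q_n$ be quivers. (In particular, $k$ may be algebraically closed and the $Q_m$ finite, connected and acyclic.) An $n$-representation $\bar V$ of $(Q_1,\dots,Q_n)$ over $k$ consists of a $k$-linear representation $V^{(m)}$ of $Q_m$ for each $m \in \{1,\dots,n\}$, together with a $k$-linear map $\psi_{\alpha,\beta} : V^{(m-1)}_{t(\alpha)} \to V^{(m)}_{s(\beta)}$ for each $m \in \{2,\dots,n\}$ and each pair $(\alpha,\beta)$ consisting of an arrow $\alpha$ of $Q_{m-1}$ and an arrow $\beta$ of $Q_m$. A morphism $\bar V \to \bar W$ is an $n$-tuple of morphisms of representations $f^{(m)} : V^{(m)} \to W^{(m)}$ such that $f^{(m)}_{s(\beta)} \circ \psi^{V}_{\alpha,\beta} = \psi^{W}_{\alpha,\beta} \circ f^{(m-1)}_{t(\alpha)}$ for all such $m,\alpha,\beta$. These form a category $\mathrm{Rep}_{(Q_1,\dots,Q_n)}$. It is monoidal under the vertexwise tensor product over $k$ (arrows and the linking maps $\psi$ act by the tensor products of the given maps), with unit object equal to $k$ at every vertex and with all maps the identity. Let $\mathrm{CoAlg}(\mathrm{Rep}_{(Q_1,\dots,Q_n)})$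 be the category of coalgebras (coassociative, counital comonoids) in this monoidal category, and let $$\mathscr U_n : \mathrm{CoAlg}(\mathrm{Rep}_{(Q_1,\dots,Q_n)}) \to \mathrm{Rep}_{(Q_1,\dots,Q_n)}$$ be the forgetful functor. Then $\mathscr U_n$ has a right adjoint. Equivalently, the concrete category $(\mathrm{CoAlg}(\mathrm{Rep}_{(Q_1,\dots,Q_n)}),\mathscr U_n)$ has cofree objects: $\mathscr U_n$ is faithful, and for every $n$-representation $\bar M$ there are a coalgebra $C$ and a morphism $\varepsilon : \mathscr U_n C \to \bar M$ such that for every coalgebra $D$ and every morphism $f : \mathscr U_n D \to \bar M$ there is a unique coalgebra morphism $g : D \to C$ with $\varepsilon \circ \mathscr U_n(g) = f$. -/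

import Mathlib

universe u v w

open CategoryTheory MonoidalCategory

/-- An `n`-representation of the quivers `(Q 0, …, Q (n - 1))` over the field `k`: a
representation of each quiver (a vector space at every vertex, a linear map along every arrow),
together with, for any two consecutive indices `m`, `m'`, a linear map
`ψ : V^(m)_{t(α)} ⟶ V^(m')_{s(β)}` for each pair of arrows `α` of `Q m` and `β` of `Q m'`. -/
structure NRep (k : Type u) [Field k] {n : ℕ} (Q : Fin n → Type v) [∀ m, Quiver.{w} (Q m)] where
  rep : ∀ m, Q m ⥤q ModuleCat.{u} k
  link : ∀ (m m' : Fin n), (m : ℕ) + 1 = m' → ∀ {i j : Q m} {i' j' : Q m'},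
    (i ⟶ j) → (i' ⟶ j') → ((rep m).obj j ⟶ (rep m').obj i')

namespace NRep

variable {k : Type u} [Field k] {n : ℕ} {Q : Fin n → Type v} [∀ m, Quiver.{w} (Q m)]

/-- A morphism of `n`-representations: linear maps at all vertices of all the quivers, commuting
with the maps along the arrows and with the linking maps. -/
@[ext]
structure Hom (V W : NRep k Q) where
  app : ∀ (m : Fin n) (i : Q m), (V.rep m).obj i ⟶ (W.rep m).obj i
  naturality : ∀ (m : Fin n) {i j : Q m} (α : i ⟶ j),
    (V.rep m).map α ≫ app m j = app m i ≫ (W.rep m).map α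
  link_comm : ∀ (m m' : Fin n) (h : (m : ℕ) + 1 = m') {i j : Q m} {i' j' : Q m'}
    (α : i ⟶ j) (β : i' ⟶ j'),
    V.link m m' h α β ≫ app m' i' = app m j ≫ W.link m m' h α β

instance : Category (NRep k Q) where
  Hom := Hom
  id V :=
    { app := fun _ _ => 𝟙 _
      naturality := by simp
      link_comm := by simp }
  comp f g :=
    { app := fun m i => f.app m i ≫ g.app m i
      naturality := fun m _ _ α => by
        rw [← Category.assoc, f.naturality, Category.assoc, g.naturality, Category.assoc]
      link_comm := fun m m' h _ _ _ _ α β => by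
        rw [← Category.assoc, f.link_comm, Category.assoc, g.link_comm, Category.assoc] }
  id_comp f := Hom.ext (by funext m i; exact Category.id_comp _)
  comp_id f := Hom.ext (by funext m i; exact Category.comp_id _)
  assoc f g h := Hom.ext (by funext m i; exact Category.assoc _ _ _)

@[ext]
theorem hom_ext {V W : NRep k Q} {f g : V ⟶ W} (h : ∀ m i, f.app m i = g.app m i) : f = g :=
  Hom.ext (by funext m i; exact h m i)

@[simp]
theorem id_app (V : NRep k Q) (m : Fin n) (i : Q m) : Hom.app (𝟙 V) m i = 𝟙 _ := rfl

@[simp]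
theorem comp_app {U V W : NRep k Q} (f : U ⟶ V) (g : V ⟶ W) (m : Fin n) (i : Q m) :
    Hom.app (f ≫ g) m i = f.app m i ≫ g.app m i := rfl

/-- An isomorphism of `n`-representations from vertexwise isomorphisms. -/
@[simps]
def isoMk {V W : NRep k Q} (e : ∀ (m : Fin n) (i : Q m), (V.rep m).obj i ≅ (W.rep m).obj i)
    (hn : ∀ (m : Fin n) {i j : Q m} (α : i ⟶ j),
      (V.rep m).map α ≫ (e m j).hom = (e m i).hom ≫ (W.rep m).map α)
    (hl : ∀ (m m' : Fin n) (h : (m : ℕ) + 1 = m') {i j : Q m} {i' j' : Q m'}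
      (α : i ⟶ j) (β : i' ⟶ j'),
      V.link m m' h α β ≫ (e m' i').hom = (e m j).hom ≫ W.link m m' h α β) : V ≅ W where
  hom :=
    { app := fun m i => (e m i).hom
      naturality := hn
      link_comm := hl }
  inv :=
    { app := fun m i => (e m i).inv
      naturality := fun m _ _ α => by
        rw [Iso.comp_inv_eq, Category.assoc, hn, Iso.inv_hom_id_assoc]
      link_comm := fun m m' h _ _ _ _ α β => by
        rw [Iso.comp_inv_eq, Category.assoc, hl, Iso.inv_hom_id_assoc] }
  hom_inv_id := by ext1; simp
  inv_hom_id := by ext1; simp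

/-- The vertexwise tensor product over `k`; arrows and linking maps act by the tensor products of
the given maps. -/
def tensor (V W : NRep k Q) : NRep k Q where
  rep m :=
    { obj := fun i => (V.rep m).obj i ⊗ (W.rep m).obj i
      map := fun α => (V.rep m).map α ⊗ₘ (W.rep m).map α }
  link m m' h _ _ _ _ α β := V.link m m' h α β ⊗ₘ W.link m m' h α β

/-- The unit `n`-representation: `k` at every vertex, with identity maps throughout. -/
def unit : NRep k Q where
  rep _ :=
    { obj := fun _ => 𝟙_ (ModuleCat.{u} k)
      map := fun _ => 𝟙 (𝟙_ (ModuleCat.{u} k)) }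
  link _ _ _ _ _ _ _ _ _ := 𝟙 (𝟙_ (ModuleCat.{u} k))

theorem tensor_square {A A' B B' C C' D D' : ModuleCat.{u} k}
    {f : A ⟶ B} {g : B ⟶ D} {p : A ⟶ C} {q : C ⟶ D}
    {f' : A' ⟶ B'} {g' : B' ⟶ D'} {p' : A' ⟶ C'} {q' : C' ⟶ D'}
    (h : f ≫ g = p ≫ q) (h' : f' ≫ g' = p' ≫ q') :
    (f ⊗ₘ f') ≫ (g ⊗ₘ g') = (p ⊗ₘ p') ≫ (q ⊗ₘ q') := by
  rw [tensorHom_comp_tensorHom, tensorHom_comp_tensorHom, h, h']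

theorem leftUnitor_square {A B : ModuleCat.{u} k} (f : A ⟶ B) :
    (𝟙 (𝟙_ (ModuleCat.{u} k)) ⊗ₘ f) ≫ (λ_ B).hom = (λ_ A).hom ≫ f := by
  rw [id_tensorHom, leftUnitor_naturality]

theorem rightUnitor_square {A B : ModuleCat.{u} k} (f : A ⟶ B) :
    (f ⊗ₘ 𝟙 (𝟙_ (ModuleCat.{u} k))) ≫ (ρ_ B).hom = (ρ_ A).hom ≫ f := by
  rw [tensorHom_id, rightUnitor_naturality]

theorem whiskerLeft_square {A B A' B' C' D' : ModuleCat.{u} k} {f : A ⟶ B}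
    {f' : A' ⟶ B'} {g' : B' ⟶ D'} {p' : A' ⟶ C'} {q' : C' ⟶ D'}
    (h' : f' ≫ g' = p' ≫ q') : (f ⊗ₘ f') ≫ (B ◁ g') = (A ◁ p') ≫ (f ⊗ₘ q') := by
  rw [← id_tensorHom, ← id_tensorHom]
  exact tensor_square (by simp) h'

theorem whiskerRight_square {A B C D A' B' : ModuleCat.{u} k} {f' : A' ⟶ B'}
    {f : A ⟶ B} {g : B ⟶ D} {p : A ⟶ C} {q : C ⟶ D}
    (h : f ≫ g = p ≫ q) : (f ⊗ₘ f') ≫ (g ▷ B') = (p ▷ A') ≫ (q ⊗ₘ f') := by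
  rw [← tensorHom_id, ← tensorHom_id]
  exact tensor_square h (by simp)

/-- The tensor product of morphisms, and the structural isomorphisms, are those of vector spaces at
every vertex. -/
instance : MonoidalCategoryStruct (NRep k Q) where
  tensorObj := tensor
  whiskerLeft V _ _ g :=
    { app := fun m i => (V.rep m).obj i ◁ g.app m i
      naturality := fun m _ _ α => whiskerLeft_square (g.naturality m α)
      link_comm := fun m m' h _ _ _ _ α β => whiskerLeft_square (g.link_comm m m' h α β) }
  whiskerRight f W :=
    { app := fun m i => f.app m i ▷ (W.rep m).obj i
      naturality := fun m _ _ α => whiskerRight_square (f.naturality m α)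
      link_comm := fun m m' h _ _ _ _ α β => whiskerRight_square (f.link_comm m m' h α β) }
  tensorHom f g :=
    { app := fun m i => f.app m i ⊗ₘ g.app m i
      naturality := fun m _ _ α => tensor_square (f.naturality m α) (g.naturality m α)
      link_comm := fun m m' h _ _ _ _ α β =>
        tensor_square (f.link_comm m m' h α β) (g.link_comm m m' h α β) }
  tensorUnit := unit
  associator U V W := isoMk (fun m i => α_ ((U.rep m).obj i) ((V.rep m).obj i) ((W.rep m).obj i))
    (fun _ _ _ _ => associator_naturality _ _ _)
    (fun _ _ _ _ _ _ _ _ _ => associator_naturality _ _ _)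
  leftUnitor V := isoMk (fun m i => λ_ ((V.rep m).obj i))
    (fun _ _ _ _ => leftUnitor_square _) (fun _ _ _ _ _ _ _ _ _ => leftUnitor_square _)
  rightUnitor V := isoMk (fun m i => ρ_ ((V.rep m).obj i))
    (fun _ _ _ _ => rightUnitor_square _) (fun _ _ _ _ _ _ _ _ _ => rightUnitor_square _)

/-- The category of `n`-representations is monoidal under the vertexwise tensor product. -/
instance : MonoidalCategory (NRep k Q) where
  tensorHom_def _ _ := hom_ext fun _ _ => MonoidalCategory.tensorHom_def _ _
  id_tensorHom_id _ _ := hom_ext fun _ _ => MonoidalCategory.id_tensorHom_id _ _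
  tensorHom_comp_tensorHom _ _ _ _ :=
    hom_ext fun _ _ => MonoidalCategory.tensorHom_comp_tensorHom _ _ _ _
  whiskerLeft_id _ _ := hom_ext fun _ _ => MonoidalCategory.whiskerLeft_id _ _
  id_whiskerRight _ _ := hom_ext fun _ _ => MonoidalCategory.id_whiskerRight _ _
  associator_naturality _ _ _ :=
    hom_ext fun _ _ => MonoidalCategory.associator_naturality _ _ _
  leftUnitor_naturality _ := hom_ext fun _ _ => MonoidalCategory.leftUnitor_naturality _
  rightUnitor_naturality _ := hom_ext fun _ _ => MonoidalCategory.rightUnitor_naturality _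
  pentagon _ _ _ _ := hom_ext fun _ _ => MonoidalCategory.pentagon _ _ _ _
  triangle _ _ := hom_ext fun _ _ => MonoidalCategory.triangle _ _

end NRep

/-- `C` together with `ε : U.obj C ⟶ Y` is a cofree object over `Y` with respect to `U` (that is,
`(C, ε)` is a co-universal arrow): every `f : U.obj D ⟶ Y` factors as `U.map g ≫ ε` for a unique
`g : D ⟶ C`. -/
def IsCofreeObject {A : Type*} [Category A] {X : Type*} [Category X] (U : A ⥤ X) (Y : X)
    (C : A) (ε : U.obj C ⟶ Y) : Prop :=
  ∀ (D : A) (f : U.obj D ⟶ Y), ∃! g : D ⟶ C, U.map g ≫ ε = f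

/-- The category `A`, made concrete over `X` by the faithful functor `U`, has cofree objects. -/
def HasCofreeObjects {A : Type*} [Category A] {X : Type*} [Category X] (U : A ⥤ X) : Prop :=
  U.Faithful ∧ ∀ Y : X, ∃ (C : A) (ε : U.obj C ⟶ Y), IsCofreeObject U Y C ε

/-!
A coalgebra in `n`-representations is a coalgebra at every vertex together with coalgebra morphisms
along the arrows and the links (`NRep.vertexComon`, `NRep.vertexComonMap`, `NRep.vertexComonLink`).
A right adjoint `R` of the forgetful functor from coalgebras to vector spaces can therefore be
applied at every vertex and to every arrow and link (`NRep.mapComon`), and naturality of the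
adjunction makes the result cofree (`NRep.isCofreeObject_mapComon`). No property of the quivers
is needed.

It remains to construct the cofree coalgebra on a vector space `V`. Classically it is the largest
subspace `C` of the completed tensor algebra `∏ V^{⊗ n}` on which deconcatenation takes values in
`C ⊗ C`. An element of the completed tensor algebra is recorded here by its values on words in
linear forms on `V`, that is, by a function on the free monoid `G` on the dual of `V`;
deconcatenation becomes `s ↦ ((a, b) ↦ s (a * b))`. Over a field `C ⊗ C` embeds into the functions
on `G × G` (`tensorEval_injective`), so being closed under comultiplication is a property of a
space of functions, it is preserved by sums of subspaces (`Submodule.IsComulClosed.sSup`), and the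
coalgebra laws follow from the monoid laws of `G` (`Submodule.IsComulClosed.coalgebra`).

For a coalgebra `D`, the linear forms on `D` are a monoid under convolution. A coalgebra morphism
`D → C` is the same as a monoid homomorphism from `G` to this monoid whose values on letters come
from a linear map `f : D → V`. As `G` is free, there is exactly one such homomorphism for every `f`
(`Cofree.lift`, `Cofree.hom_ext_proj`).
-/

/-! ### Tensor products of spaces of functions -/

open TensorProduct in
/-- The pairing of two linear maps into function spaces: `m ⊗ n` is sent to the function
`(a, b) ↦ f m a * g n b` of two variables. -/
noncomputable def tensorEval {k M N A B : Type*} [Field k] [AddCommGroup M] [Module k M]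
    [AddCommGroup N] [Module k N] (f : M →ₗ[k] A → k) (g : N →ₗ[k] B → k) :
    M ⊗[k] N →ₗ[k] A × B → k :=
  LinearMap.pi fun p => LinearMap.mul' k k ∘ₗ
    TensorProduct.map (LinearMap.proj p.1 ∘ₗ f) (LinearMap.proj p.2 ∘ₗ g)

section TensorEval

open TensorProduct

variable {k M N M' N' A B : Type*} [Field k] [AddCommGroup M] [Module k M]
  [AddCommGroup N] [Module k N] [AddCommGroup M'] [Module k M'] [AddCommGroup N'] [Module k N']

@[simp]
theorem tensorEval_tmul (f : M →ₗ[k] A → k) (g : N →ₗ[k] B → k) (x : M) (y : N) (p : A × B) :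
    tensorEval f g (x ⊗ₜ y) p = f x p.1 * g y p.2 := rfl

theorem tensorEval_map (f : M →ₗ[k] A → k) (g : N →ₗ[k] B → k) (p : M' →ₗ[k] M)
    (q : N' →ₗ[k] N) (t : M' ⊗[k] N') :
    tensorEval f g (TensorProduct.map p q t) = tensorEval (f ∘ₗ p) (g ∘ₗ q) t := by
  induction t with
  | zero => simp
  | tmul x y => rfl
  | add x y hx hy => simp only [map_add, hx, hy]

/-- A basis of `N` identifies an element of `M ⊗ N` with its family of coordinates in `M`. If the
function attached to the element vanishes, then fixing its first variable shows that all these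
coordinates are zero. -/
theorem tensorEval_injective {f : M →ₗ[k] A → k} {g : N →ₗ[k] B → k}
    (hf : Function.Injective f) (hg : Function.Injective g) :
    Function.Injective (tensorEval f g) := by
  classical
  rw [injective_iff_map_eq_zero]
  intro t ht
  let φ (a : A) : M ⊗[k] N →ₗ[k] N :=
    (TensorProduct.lid k N).toLinearMap ∘ₗ (LinearMap.proj a ∘ₗ f).rTensor N
  have hφ (a : A) (x : M ⊗[k] N) (b : B) : g (φ a x) b = tensorEval f g x (a, b) := by
    induction x with
    | zero => simp
    | tmul x y => simp [φ]
    | add x y hx hy => simp only [map_add, Pi.add_apply, hx, hy]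
  let 𝒞 := Module.Basis.ofVectorSpace k N
  have hcoord (a : A) (x : M ⊗[k] N) (i) :
      𝒞.repr (φ a x) i = f (TensorProduct.equivFinsuppOfBasisRight 𝒞 x i) a := by
    induction x with
    | zero => simp
    | tmul x y => simp [φ, mul_comm]
    | add x y hx hy => simp only [map_add, Finsupp.add_apply, Pi.add_apply, hx, hy]
  apply (TensorProduct.equivFinsuppOfBasisRight 𝒞).injective
  rw [map_zero]
  ext i
  apply hf
  funext a
  have h0 : φ a t = 0 := hg (by funext b; rw [hφ, ht, map_zero]; rfl)
  rw [← hcoord, h0]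
  simp

theorem tensorEval_assoc {C P : Type*} [AddCommGroup P] [Module k P]
    (f : M →ₗ[k] A → k) (g : N →ₗ[k] B → k) (h : P →ₗ[k] C → k) (t : M ⊗[k] N) (z : P)
    (a : A) (b : B) (c : C) :
    tensorEval f (tensorEval g h) (TensorProduct.assoc k M N P (t ⊗ₜ z)) (a, b, c) =
      tensorEval f g t (a, b) * h z c := by
  induction t with
  | zero => simp
  | tmul x y => simp [mul_assoc]
  | add x y hx hy => simp only [add_tmul, map_add, Pi.add_apply, hx, hy, add_mul]

theorem tensorEval_subtype_injective (S : Submodule k (A → k)) :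
    Function.Injective (tensorEval S.subtype S.subtype) :=
  tensorEval_injective S.injective_subtype S.injective_subtype

end TensorEval

/-! ### Coalgebras of functions on a monoid -/

namespace Submodule

open TensorProduct

variable {k G : Type*} [Field k] [Monoid G]

/-- A space `S` of functions on a monoid is closed under comultiplication if, for every `s ∈ S`,
the function `(a, b) ↦ s (a * b)` belongs to `S ⊗ S`. -/
def IsComulClosed (S : Submodule k (G → k)) : Prop :=
  ∀ s ∈ S, ∃ t : S ⊗[k] S, ∀ a b, tensorEval S.subtype S.subtype t (a, b) = s (a * b)

theorem IsComulClosed.sSup {𝒮 : Set (Submodule k (G → k))} (h : ∀ S ∈ 𝒮, S.IsComulClosed) :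
    (sSup 𝒮).IsComulClosed := by
  intro s hs
  rw [sSup_eq_iSup'] at hs
  induction hs using Submodule.iSup_induction' with
  | mem S s hs =>
    obtain ⟨t, ht⟩ := h S S.2 s hs
    have hle : S.1 ≤ SupSet.sSup 𝒮 := le_sSup S.2
    refine ⟨TensorProduct.map (inclusion hle) (inclusion hle) t, fun a b => ?_⟩
    rw [tensorEval_map]
    exact ht a b
  | zero => exact ⟨0, by simp⟩
  | add x y _ _ hx hy =>
    obtain ⟨t, ht⟩ := hx
    obtain ⟨t', ht'⟩ := hy
    exact ⟨t + t', fun a b => by simp [ht, ht']⟩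

namespace IsComulClosed

variable {S : Submodule k (G → k)} (hS : S.IsComulClosed)

/-- The comultiplication of a space of functions on a monoid, dual to the multiplication of the
monoid. -/
noncomputable def comul : S →ₗ[k] S ⊗[k] S where
  toFun s := (hS s s.2).choose
  map_add' s s' := tensorEval_subtype_injective S <| by
    funext ⟨a, b⟩
    rw [map_add, Pi.add_apply, (hS _ (s + s').2).choose_spec, (hS _ s.2).choose_spec,
      (hS _ s'.2).choose_spec]
    rfl
  map_smul' c s := tensorEval_subtype_injective S <| by
    funext ⟨a, b⟩
    rw [map_smul, Pi.smul_apply, (hS _ (c • s).2).choose_spec, RingHom.id_apply,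
      (hS _ s.2).choose_spec]
    rfl

@[simp]
theorem tensorEval_comul (s : S) (a b : G) :
    tensorEval S.subtype S.subtype (hS.comul s) (a, b) = s.1 (a * b) :=
  (hS s s.2).choose_spec a b

/-- The coalgebra of functions on a monoid belonging to a comultiplication-closed space. Its
counit is evaluation at `1`. -/
noncomputable abbrev coalgebra : Coalgebra k S where
  comul := hS.comul
  counit := LinearMap.proj 1 ∘ₗ S.subtype
  coassoc := by
    -- As functions of three variables, both sides are `(a, b, c) ↦ s (a * b * c)`.
    have hinj := tensorEval_injective (f := S.subtype) (g := tensorEval S.subtype S.subtype)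
      S.injective_subtype (tensorEval_subtype_injective S)
    ext1 s
    apply hinj
    funext ⟨a, b, c⟩
    have hl (t : S ⊗[k] S) : tensorEval S.subtype (tensorEval S.subtype S.subtype)
        (TensorProduct.assoc k S S S (hS.comul.rTensor S t)) (a, b, c) =
          tensorEval S.subtype S.subtype t (a * b, c) := by
      induction t with
      | zero => simp
      | tmul x y => simp [tensorEval_assoc]
      | add x y hx hy => simp only [map_add, Pi.add_apply, hx, hy]
    have hr (t : S ⊗[k] S) : tensorEval S.subtype (tensorEval S.subtype S.subtype)
        (hS.comul.lTensor S t) (a, b, c) = tensorEval S.subtype S.subtype t (a, b * c) := by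
      induction t with
      | zero => simp
      | tmul x y => simp
      | add x y hx hy => simp only [map_add, Pi.add_apply, hx, hy]
    simp only [LinearMap.comp_apply, LinearEquiv.coe_coe]
    rw [hl, hr, tensorEval_comul, tensorEval_comul, mul_assoc]
  rTensor_counit_comp_comul := by
    ext1 s
    apply (TensorProduct.lid k S).injective
    apply Subtype.ext
    funext b
    have h (t : S ⊗[k] S) : (TensorProduct.lid k S
        ((LinearMap.proj 1 ∘ₗ S.subtype).rTensor S t)).1 b =
          tensorEval S.subtype S.subtype t (1, b) := by
      induction t with
      | zero => simp
      | tmul x y => simp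
      | add x y hx hy => simp only [map_add, Submodule.coe_add, Pi.add_apply, hx, hy]
    simp [h]
  lTensor_counit_comp_comul := by
    ext1 s
    apply (TensorProduct.rid k S).injective
    apply Subtype.ext
    funext b
    have h (t : S ⊗[k] S) : (TensorProduct.rid k S
        ((LinearMap.proj 1 ∘ₗ S.subtype).lTensor S t)).1 b =
          tensorEval S.subtype S.subtype t (b, 1) := by
      induction t with
      | zero => simp
      | tmul x y => simp [mul_comm]
      | add x y hx hy => simp only [map_add, Submodule.coe_add, Pi.add_apply, hx, hy]
    simp [h]

end IsComulClosed

end Submodule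

/-! ### The cofree coalgebra on a vector space -/

theorem Module.eq_of_forall_dual_apply_eq (k : Type*) {V : Type*} [Field k] [AddCommGroup V]
    [Module k V] {x y : V} (h : ∀ l : Module.Dual k V, l x = l y) : x = y :=
  sub_eq_zero.mp <| (Module.forall_dual_apply_eq_zero_iff k _).mp fun l => by
    rw [map_sub, h, sub_self]

section Cofree

open TensorProduct Module WithConv

variable (k V : Type*) [Field k] [AddCommGroup V] [Module k V]

/-- The spaces `S` of functions on words in linear forms on `V` that are closed under
comultiplication and on whose members evaluation at one-letter words is evaluation at a vector
of `V`, rather than merely at an element of the double dual. -/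
def cofreeSpaces : Set (Submodule k (FreeMonoid (Dual k V) → k)) :=
  {S | S.IsComulClosed ∧ ∀ s ∈ S, ∃ x : V, ∀ l : Dual k V, s (FreeMonoid.of l) = l x}

/-- The cofree coalgebra on `V`, as the largest of the spaces in `cofreeSpaces k V`. A word
`l₁ ⋯ lₙ` evaluates the component in `V^{⊗ n}` of an element of the completed tensor algebra. -/
abbrev Cofree : Type _ := ↥(sSup (cofreeSpaces k V))

namespace Cofree

theorem isComulClosed : (sSup (cofreeSpaces k V)).IsComulClosed :=
  .sSup fun _ h => h.1

noncomputable instance : Coalgebra k (Cofree k V) := (isComulClosed k V).coalgebra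

variable {k V}

theorem tensorEval_comul (s : Cofree k V) (a b : FreeMonoid (Dual k V)) :
    tensorEval (Submodule.subtype _) (Submodule.subtype _) (Coalgebra.comul (R := k) s) (a, b) =
      s.1 (a * b) :=
  (isComulClosed k V).tensorEval_comul s a b

theorem exists_eval (s : Cofree k V) : ∃ x : V, ∀ l : Dual k V, s.1 (FreeMonoid.of l) = l x := by
  obtain ⟨s, hs⟩ := s
  change ∃ x : V, ∀ l : Dual k V, s (FreeMonoid.of l) = l x
  rw [sSup_eq_iSup'] at hs
  induction hs using Submodule.iSup_induction' with
  | mem S s hs => exact S.2.2 s hs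
  | zero => exact ⟨0, by simp⟩
  | add s t _ _ hs ht =>
    obtain ⟨x, hx⟩ := hs
    obtain ⟨y, hy⟩ := ht
    exact ⟨x + y, fun l => by simpa using congr($(hx l) + $(hy l))⟩

/-- The projection of the cofree coalgebra to `V`, determined by the values on one-letter words. -/
noncomputable def proj : Cofree k V →ₗ[k] V where
  toFun s := (exists_eval s).choose
  map_add' s t := by
    refine Module.eq_of_forall_dual_apply_eq k fun l => ?_
    rw [map_add, ← (exists_eval (s + t)).choose_spec, ← (exists_eval s).choose_spec,
      ← (exists_eval t).choose_spec]
    rfl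
  map_smul' c s := by
    refine Module.eq_of_forall_dual_apply_eq k fun l => ?_
    rw [RingHom.id_apply, map_smul, ← (exists_eval (c • s)).choose_spec,
      ← (exists_eval s).choose_spec]
    rfl

theorem dual_proj (l : Dual k V) (s : Cofree k V) : l (proj s) = s.1 (FreeMonoid.of l) :=
  ((exists_eval s).choose_spec l).symm

variable {D : Type*} [AddCommGroup D] [Module k D] [Coalgebra k D]

/-- The linear forms on `D` obtained by evaluating words: a linear map `f : D → V` turns a letter
`l` into the form `l ∘ f`, and a word into the convolution product of the forms of its letters. -/
noncomputable def wordForm (f : D →ₗ[k] V) :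
    FreeMonoid (Dual k V) →* WithConv (D →ₗ[k] k) :=
  FreeMonoid.lift fun l => toConv (l ∘ₗ f)

/-- The map from a coalgebra to functions on words induced by a linear map to `V`. -/
noncomputable def wordEval (f : D →ₗ[k] V) : D →ₗ[k] FreeMonoid (Dual k V) → k :=
  LinearMap.pi fun a => (wordForm f a).ofConv

theorem wordEval_one (f : D →ₗ[k] V) (d : D) :
    wordEval f d 1 = Coalgebra.counit (R := k) d := by
  simp [wordEval, LinearMap.convOne_def]

theorem wordEval_of (f : D →ₗ[k] V) (d : D) (l : Dual k V) :
    wordEval f d (FreeMonoid.of l) = l (f d) := by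
  simp [wordEval, wordForm]

theorem wordEval_mul (f : D →ₗ[k] V) (d : D) (a b : FreeMonoid (Dual k V)) :
    wordEval f d (a * b) =
      tensorEval (wordEval f) (wordEval f) (Coalgebra.comul (R := k) d) (a, b) := by
  rw [wordEval, LinearMap.pi_apply, map_mul]
  rfl

theorem wordEval_mem (f : D →ₗ[k] V) (d : D) : wordEval f d ∈ sSup (cofreeSpaces k V) := by
  refine Submodule.mem_sSup_of_mem (s := LinearMap.range (wordEval f))
    (show _ ∧ _ from ⟨?_, ?_⟩) ⟨d, rfl⟩
  -- The range itself is one of the spaces in `cofreeSpaces k V`: its comultiplication is the image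
  -- of that of `D`.
  · rintro _ ⟨d, rfl⟩
    refine ⟨TensorProduct.map (wordEval f).rangeRestrict (wordEval f).rangeRestrict
      (Coalgebra.comul (R := k) d), fun a b => ?_⟩
    rw [tensorEval_map, wordEval_mul]
    rfl
  · rintro _ ⟨d, rfl⟩
    exact ⟨f d, wordEval_of f d⟩

/-- The coalgebra morphism to the cofree coalgebra induced by a linear map to `V`. -/
noncomputable def lift (f : D →ₗ[k] V) : D →ₗc[k] Cofree k V where
  toLinearMap := (wordEval f).codRestrict _ (wordEval_mem f)
  counit_comp := by
    ext d
    exact wordEval_one f d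
  map_comp_comul := by
    ext1 d
    apply tensorEval_subtype_injective
    funext ⟨a, b⟩
    rw [LinearMap.comp_apply, tensorEval_map, LinearMap.comp_apply, tensorEval_comul]
    exact (wordEval_mul f d a b).symm

theorem proj_lift (f : D →ₗ[k] V) (d : D) : proj (lift f d) = f d :=
  Module.eq_of_forall_dual_apply_eq k fun l =>
    (dual_proj l _).trans (wordEval_of f d l)

/-- The linear forms `d ↦ g d a`, for a coalgebra morphism `g` to the cofree coalgebra, are
multiplicative in the word `a`, so they are determined by the one-letter words, that is, by
`proj ∘ g`. -/
theorem hom_ext_proj {g h : D →ₗc[k] Cofree k V} (H : ∀ d, proj (g d) = proj (h d)) : g = h := by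
  let φ (g : D →ₗc[k] Cofree k V) : FreeMonoid (Dual k V) →* WithConv (D →ₗ[k] k) :=
    { toFun := fun a => toConv (LinearMap.proj a ∘ₗ Submodule.subtype _ ∘ₗ g.toLinearMap)
      map_one' := by
        ext d
        exact LinearMap.congr_fun g.counit_comp d
      map_mul' := fun a b => by
        ext d
        have hd := LinearMap.congr_fun g.map_comp_comul d
        have := congr(tensorEval (Submodule.subtype _) (Submodule.subtype _) $hd (a, b))
        rw [LinearMap.comp_apply, tensorEval_map, LinearMap.comp_apply, tensorEval_comul] at this
        exact this.symm }
  have hφ : φ g = φ h := FreeMonoid.hom_eq fun l => by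
    ext d
    exact (dual_proj l (g d)).symm.trans ((congrArg l (H d)).trans (dual_proj l (h d)))
  ext d a
  exact congr(($hφ a).ofConv d)

end Cofree

end Cofree

open ComonObj

/-! ### Cofree objects and right adjoints -/

theorem isLeftAdjoint_of_isCofreeObject {A : Type*} [Category A] {X : Type*} [Category X]
    {U : A ⥤ X}
    (h : ∀ Y : X, ∃ (C : A) (e : U.obj C ⟶ Y), IsCofreeObject U Y C e) : U.IsLeftAdjoint := by
  choose C e he using h
  let E (D : A) (Y : X) : (U.obj D ⟶ Y) ≃ (D ⟶ C Y) :=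
    { toFun := fun f => (he Y D f).choose
      invFun := fun g => U.map g ≫ e Y
      left_inv := fun f => (he Y D f).choose_spec.1
      right_inv := fun g => ((he Y D _).choose_spec.2 g rfl).symm }
  refine (Adjunction.adjunctionOfEquivRight (F := U) E fun D' D Y g f => ?_).isLeftAdjoint
  exact ((he Y D' _).choose_spec.2 (g ≫ E D Y f) <|
    show U.map (g ≫ E D Y f) ≫ e Y = U.map g ≫ f by
      rw [U.map_comp, Category.assoc]
      exact congrArg _ ((E D Y).left_inv f)).symm

/-! ### Cofree coalgebras as cofree comonoids in vector spaces -/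

/-- Cofree comonoids in vector spaces are the cofree coalgebras. -/
theorem exists_isCofreeObject_moduleCat {k : Type u} [Field k] (V : ModuleCat.{u} k) :
    ∃ (C : Comon (ModuleCat.{u} k)) (e : (Comon.forget _).obj C ⟶ V),
      IsCofreeObject (Comon.forget (ModuleCat.{u} k)) V C e := by
  refine ⟨(CoalgCat.toComon k).obj (CoalgCat.of k (Cofree k V)), ModuleCat.ofHom Cofree.proj,
    fun D f => ?_⟩
  let _ : Coalgebra k D.X := ((CoalgCat.ofComon k).obj D).instCoalgebra
  let f' : D.X →ₗ[k] V := f.hom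
  let l : D.X →ₗc[k] Cofree k V := Cofree.lift f'
  have hl (d : D.X) : Cofree.proj (l d) = f' d := Cofree.proj_lift f' d
  refine ⟨(CoalgCat.toComon k).map (X := (CoalgCat.ofComon k).obj D) ⟨l⟩,
    ModuleCat.hom_ext (LinearMap.ext hl), fun g hg => ?_⟩
  let g' : D.X →ₗc[k] Cofree k V := ((CoalgCat.ofComon k).map g).1
  have hg' : g' = l := Cofree.hom_ext_proj fun d =>
    (ConcreteCategory.congr_hom hg d).trans (hl d).symm
  exact Comon.ext (ModuleCat.hom_ext (LinearMap.ext fun d => DFunLike.congr_fun hg' d))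

instance isLeftAdjoint_forget_moduleCat (k : Type u) [Field k] :
    (Comon.forget (ModuleCat.{u} k)).IsLeftAdjoint :=
  isLeftAdjoint_of_isCofreeObject exists_isCofreeObject_moduleCat

/-! ### Coalgebras in `n`-representations, vertex by vertex -/

namespace NRep

variable {k : Type u} [Field k] {n : ℕ} {Q : Fin n → Type v} [∀ m, Quiver.{w} (Q m)]

/-- The coalgebra at a vertex of a coalgebra in `n`-representations. -/
def vertexComon (D : Comon (NRep k Q)) (m : Fin n) (i : Q m) : Comon (ModuleCat.{u} k) where
  X := (D.X.rep m).obj i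
  comon :=
    { counit := ε[D.X].app m i
      comul := Δ[D.X].app m i
      counit_comul := congr(Hom.app $(counit_comul D.X) m i)
      comul_counit := congr(Hom.app $(comul_counit D.X) m i)
      comul_assoc := congr(Hom.app $(comul_assoc D.X) m i) }

/-- The map along an arrow, as a morphism of coalgebras. -/
def vertexComonMap (D : Comon (NRep k Q)) (m : Fin n) {i j : Q m} (α : i ⟶ j) :
    vertexComon D m i ⟶ vertexComon D m j where
  hom := (D.X.rep m).map α
  isComonHom_hom :=
    { hom_counit := (ε[D.X].naturality m α).trans (Category.comp_id _)
      hom_comul := Δ[D.X].naturality m α }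

/-- A linking map, as a morphism of coalgebras. -/
def vertexComonLink (D : Comon (NRep k Q)) (m m' : Fin n) (h : (m : ℕ) + 1 = m')
    {i j : Q m} {i' j' : Q m'} (α : i ⟶ j) (β : i' ⟶ j') :
    vertexComon D m j ⟶ vertexComon D m' i' where
  hom := D.X.link m m' h α β
  isComonHom_hom :=
    { hom_counit := (ε[D.X].link_comm m m' h α β).trans (Category.comp_id _)
      hom_comul := Δ[D.X].link_comm m m' h α β }

/-- The component at a vertex of a morphism of coalgebras. -/
def vertexComonHom {D E : Comon (NRep k Q)} (g : D ⟶ E) (m : Fin n) (i : Q m) :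
    vertexComon D m i ⟶ vertexComon E m i where
  hom := g.hom.app m i
  isComonHom_hom :=
    { hom_counit := congr(Hom.app $(IsComonHom.hom_counit g.hom) m i)
      hom_comul := congr(Hom.app $(IsComonHom.hom_comul g.hom) m i) }

/-! ### The cofree coalgebra on an `n`-representation -/

variable (R : ModuleCat.{u} k ⥤ Comon (ModuleCat.{u} k))

/-- A functor from vector spaces to coalgebras, applied at every vertex and to all arrows and
linking maps, turns an `n`-representation into a coalgebra. -/
def mapComon (M : NRep k Q) : Comon (NRep k Q) where
  X :=
    { rep := fun m =>
        { obj := fun i => (R.obj ((M.rep m).obj i)).X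
          map := fun α => (R.map ((M.rep m).map α)).hom }
      link := fun m m' h _ _ _ _ α β => (R.map (M.link m m' h α β)).hom }
  comon :=
    { counit :=
        { app := fun m i => ε[(R.obj ((M.rep m).obj i)).X]
          naturality := fun m _ _ α =>
            (IsComonHom.hom_counit (R.map ((M.rep m).map α)).hom).trans (Category.comp_id _).symm
          link_comm := fun m m' h _ _ _ _ α β =>
            (IsComonHom.hom_counit (R.map (M.link m m' h α β)).hom).trans
              (Category.comp_id _).symm }
      comul :=
        { app := fun m i => Δ[(R.obj ((M.rep m).obj i)).X]
          naturality := fun m _ _ α => IsComonHom.hom_comul (R.map ((M.rep m).map α)).hom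
          link_comm := fun m m' h _ _ _ _ α β =>
            IsComonHom.hom_comul (R.map (M.link m m' h α β)).hom }
      counit_comul := hom_ext fun _ _ => counit_comul _
      comul_counit := hom_ext fun _ _ => comul_counit _
      comul_assoc := hom_ext fun _ _ => comul_assoc _ }

variable {R} (adj : Comon.forget (ModuleCat.{u} k) ⊣ R)

/-- The counits of the adjunction at the vertices. -/
def mapComonCounit (M : NRep k Q) : (mapComon R M).X ⟶ M where
  app m i := adj.counit.app ((M.rep m).obj i)
  naturality m _ _ α := adj.counit.naturality ((M.rep m).map α)
  link_comm m m' h _ _ _ _ α β := adj.counit.naturality (M.link m m' h α β)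

/-- The morphism of coalgebras that corresponds under the adjunction to the component at a vertex
of a morphism `D ⟶ M`. -/
def vertexLift {D : Comon (NRep k Q)} {M : NRep k Q} (f : D.X ⟶ M) (m : Fin n) (i : Q m) :
    vertexComon D m i ⟶ R.obj ((M.rep m).obj i) :=
  adj.homEquiv (vertexComon D m i) ((M.rep m).obj i) (f.app m i)

/-- The correspondence of the adjunction is natural, so it turns a commutative square over a map of
vector spaces into one of coalgebras. -/
theorem homEquiv_square {C C' : Comon (ModuleCat.{u} k)} {V V' : ModuleCat.{u} k} (c : C ⟶ C')
    (a : V ⟶ V') (p : (Comon.forget _).obj C ⟶ V) (p' : (Comon.forget _).obj C' ⟶ V')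
    (h : (Comon.forget _).map c ≫ p' = p ≫ a) :
    c.hom ≫ (adj.homEquiv C' V' p').hom = (adj.homEquiv C V p).hom ≫ (R.map a).hom := by
  rw [← Comon.comp_hom', ← Comon.comp_hom', ← adj.homEquiv_naturality_left,
    ← adj.homEquiv_naturality_right, h]

/-- The morphism of coalgebras with components `vertexLift adj f m i`. -/
def mapComonLift {D : Comon (NRep k Q)} {M : NRep k Q} (f : D.X ⟶ M) : D ⟶ mapComon R M where
  hom :=
    { app := fun m i => (vertexLift adj f m i).hom
      naturality := fun m _ _ α =>
        homEquiv_square adj (vertexComonMap D m α) _ _ _ (f.naturality m α)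
      link_comm := fun m m' h _ _ _ _ α β =>
        homEquiv_square adj (vertexComonLink D m m' h α β) _ _ _ (f.link_comm m m' h α β) }
  isComonHom_hom :=
    { hom_counit := hom_ext fun m i => IsComonHom.hom_counit (vertexLift adj f m i).hom
      hom_comul := hom_ext fun m i => IsComonHom.hom_comul (vertexLift adj f m i).hom }

theorem isCofreeObject_mapComon (M : NRep k Q) :
    IsCofreeObject (Comon.forget (NRep k Q)) M (mapComon R M) (mapComonCounit adj M) := by
  intro D f
  refine ⟨mapComonLift adj f, hom_ext fun m i => ?_, fun g hg =>
    Comon.ext (hom_ext fun m i => congrArg Comon.Hom.hom (?_ : vertexComonHom g m i = _))⟩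
  · exact (adj.homEquiv_counit _ _ _).symm.trans (Equiv.symm_apply_apply _ _)
  · exact (Equiv.symm_apply_eq _).mp ((adj.homEquiv_counit _ _ _).trans congr(Hom.app $hg m i))

theorem exists_isCofreeObject (M : NRep k Q) :
    ∃ (C : Comon (NRep k Q)) (e : (Comon.forget _).obj C ⟶ M),
      IsCofreeObject (Comon.forget (NRep k Q)) M C e :=
  ⟨_, _, isCofreeObject_mapComon (Adjunction.ofIsLeftAdjoint (Comon.forget (ModuleCat.{u} k))) M⟩

end NRep

theorem propositionp14p1 (k : Type u) [Field k] (n : ℕ) (_hn : 2 ≤ n) (Q : Fin n → Type v)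
    [∀ m, Quiver.{w} (Q m)] :
    (Comon.forget (NRep k Q)).IsLeftAdjoint ∧ HasCofreeObjects (Comon.forget (NRep k Q)) :=
  ⟨isLeftAdjoint_of_isCofreeObject NRep.exists_isCofreeObject,
    inferInstance, NRep.exists_isCofreeObject⟩
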